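/- **Proposition 3.** Let $\mathbf{Z}=(Z_1,\dots,Z_d)^\top$ and $\mathbf{Z}^*=(Z_1^*,\dots,Z_d^*)^\top$ be random vectors such that $(\mathbf{Z}^\top,(\mathbf{Z}^*)^\top)^\top$ is multivariate normal with mean zero, unit variances and (possibly singular) correlation matrix $\mathbf{P}$; in particular $\mathbf{Z}$ and $\mathbf{Z}^*$ may be dependent. Let $V_0$ be a unit exponential random variable independent of $(\mathbf{Z},\mathbf{Z}^*)$, let $\alpha_1,\dots,\alpha_d>0$ and $c_1,\dots,c_d\in\mathbb{R}$, and put $$X_k = Z_k + \frac{1}{\alpha_k}\,V_0\,\mathbf{1}(Z_k^*>c_k),\qquad k=1,\dots,d.$$ Write $\rho_{k,l}=\mathrm{Cor}(Z_k,Z_l)$, $\rho_{k^*,l}=\mathrm{Cor}(Z_k^*,Z_l)$ and $\rho_{k^*,l^*}=\mathrm{Cor}(Z_k^*,Z_l^*)$. Let $i\neq j$ and assume that $$\lambda_{ij}=(\alpha_i^2-2\rho_{i,j}\alpha_i\alpha_j+\alpha_j^2)^{1/2}>0 .$$ Let $F$ be the joint distribution function of $(X_i,X_j)$, let $F_i,F_j$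 be its margins (which are continuous), and let $C(u,v)=F(F_i^{-1}(u),F_j^{-1}(v))$ be its copula, where $F_l^{-1}(u)=\inf\{x: u\le F_l(x)\}\in[-\infty,\infty]$. Then the stable tail dependence function $$\ell_{X_i,X_j}(x_i,x_j)=\lim_{n\to\infty} n\left\{1-C\left(1-\frac{x_i}{n},1-\frac{x_j}{n}\right)\right\}$$ exists for all $x_i,x_j\ge 0$ and is given by $$\begin{aligned} \ell_{X_i,X_j}(x_i,x_j)={}& x_i\left\{1-\frac{\Phi_3\left(\left(-\frac{\lambda_{ij}}{2}-\frac{1}{\lambda_{ij}}\ln\frac{\tilde x_i}{\tilde x_j},\ \alpha_i\rho_{j^*,i}-c_j,\ \alpha_i\rho_{i^*,i}-c_i\right)^\top;\boldsymbol{\Sigma}_{i|j}\right)}{\Phi(\alpha_i\rho_{i^*,i}-c_i)}\right\}\\ &+x_j\left\{1-\frac{\Phi_3\left(\left(-\frac{\lambda_{ij}}{2}-\frac{1}{\lambda_{ij}}\ln\frac{\tilde x_j}{\tilde x_i},\ \alpha_j\rho_{i^*,j}-c_i,\ \alpha_j\rho_{j^*,j}-c_j\right)^\top;\boldsymbol{\Sigma}_{j|i}\right)}{\Phi(\alpha_j\rho_{j^*,j}-c_j)}\right\}.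 \end{aligned}$$ Here $\tilde x_l=x_l/\Phi(\alpha_l\rho_{l^*,l}-c_l)$ for $l\in\{i,j\}$, $\Phi$ is the standard normal distribution function, $\Phi_3(\cdot;\boldsymbol{\Sigma})$ is the distribution function of the centered trivariate normal law with covariance matrix $\boldsymbol{\Sigma}$, $$\boldsymbol{\Sigma}_{i|j}=\begin{pmatrix}1&\frac{1}{\lambda_{ij}}(\alpha_j\rho_{j^*,j}-\alpha_i\rho_{j^*,i})&\frac{1}{\lambda_{ij}}(\alpha_j\rho_{i^*,j}-\alpha_i\rho_{i^*,i})\\ \frac{1}{\lambda_{ij}}(\alpha_j\rho_{j^*,j}-\alpha_i\rho_{j^*,i})&1&\rho_{i^*,j^*}\\ \frac{1}{\lambda_{ij}}(\alpha_j\rho_{i^*,j}-\alpha_i\rho_{i^*,i})&\rho_{i^*,j^*}&1\end{pmatrix},$$ and $\boldsymbol{\Sigma}_{j|i}$ is obtained from $\boldsymbol{\Sigma}_{i|j}$ by exchanging $i$ and $j$. On the boundary of the quadrant the formula is read with the conventions $\ln 0=-\infty$, $\ln(x/0)=+\infty$ for $x>0$, and $\Phi_3=0$ if its first argument is $-\infty$,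 a summand with factor $x_l=0$ being $0$; thus $\ell_{X_i,X_j}(x,0)=\ell_{X_i,X_j}(0,x)=x$. -/

import Mathlib

open MeasureTheory ProbabilityTheory Filter Topology

noncomputable section

/-- The generalized inverse `F⁻¹(u) = inf {x : u ≤ F x}` of the distribution function `F` of `ν`,
with values in the extended reals (so `F⁻¹(1) = +∞` when `F < 1` everywhere). -/
def quantile (ν : Measure ℝ) (u : ℝ) : EReal :=
  sInf ((fun x : ℝ => (x : EReal)) '' {x : ℝ | u ≤ cdf ν x})

/-- The copula `C(u, v) = F(F₁⁻¹(u), F₂⁻¹(v))` of a random pair `(X, Y)` with continuous margins. -/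
def bivariateCopula {Ω : Type*} [MeasurableSpace Ω] (μ : Measure Ω) (X Y : Ω → ℝ) (u v : ℝ) : ℝ :=
  μ.real {ω | (X ω : EReal) ≤ quantile (μ.map X) u ∧ (Y ω : EReal) ≤ quantile (μ.map Y) v}

/-- `ℓ` is the stable tail dependence function of the bivariate copula `C`:
`ℓ(x, y) = lim n {1 - C(1 - x/n, 1 - y/n)}` for all `x, y ≥ 0`, the limit existing. -/
def IsStableTailDependenceFunction (C : ℝ → ℝ → ℝ) (ℓ : ℝ → ℝ → ℝ) : Prop :=
  ∀ x y : ℝ, 0 ≤ x → 0 ≤ y →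
    Tendsto (fun n : ℕ => (n : ℝ) * (1 - C (1 - x / n) (1 - y / n))) atTop (𝓝 (ℓ x y))

/-- A correlation matrix (possibly singular). -/
structure IsCorrelationMatrix {ι : Type*} [Fintype ι] (P : Matrix ι ι ℝ) : Prop where
  posSemidef : P.PosSemidef
  diag : ∀ k, P k k = 1

/-- The additive factor model `X_i = Z_i + (1/α_i) · V₀ · 1(Z_i^* > c_i)`. -/
def factorModel {Ω : Type*} {d : ℕ} (α c : Fin d → ℝ) (Z Zs : Fin d → Ω → ℝ) (V₀ : Ω → ℝ)
    (i : Fin d) (ω : Ω) : ℝ :=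
  Z i ω + (1 / α i) * V₀ ω * Set.indicator {ω' | c i < Zs i ω'} (fun _ => (1 : ℝ)) ω

/-- The standard normal distribution function `Φ`. -/
def stdNormalCDF (x : ℝ) : ℝ := cdf (gaussianReal 0 1) x

/-- The distribution function `Φ_m(· ; S)` of the centered `m`-variate normal law with covariance
matrix `S`. -/
def normalCDF {m : ℕ} (S : Matrix (Fin m) (Fin m) ℝ) (x : Fin m → ℝ) : ℝ :=
  (multivariateGaussian 0 S).real {y | ∀ k, y k ≤ x k}

section SkewHuslerReiss

variable {d : ℕ} (P : Matrix (Fin d ⊕ Fin d) (Fin d ⊕ Fin d) ℝ) (α c : Fin d → ℝ) (i j : Fin d)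

/-- `ρ_{i,j} = Cor(Z_i, Z_j)`. -/
def rhoZZ : ℝ := P (.inl i) (.inl j)

/-- `ρ_{i^*,j} = Cor(Z_i^*, Z_j)`. -/
def rhoSZ : ℝ := P (.inl j) (.inr i)

/-- `ρ_{i^*,j^*} = Cor(Z_i^*, Z_j^*)`. -/
def rhoSS : ℝ := P (.inr i) (.inr j)

/-- `λ_{ij} = (α_i² - 2 ρ_{i,j} α_i α_j + α_j²)^{1/2}`. -/
def lam : ℝ := Real.sqrt (α i ^ 2 - 2 * rhoZZ P i j * α i * α j + α j ^ 2)

/-- `Φ(α_i ρ_{i^*,i} - c_i)`. -/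
def zeta : ℝ := stdNormalCDF (α i * rhoSZ P i i - c i)

/-- The matrix `Σ_{i|j}`. -/
def sigmaCond : Matrix (Fin 3) (Fin 3) ℝ :=
  !![1,
      (1 / lam P α i j) * (α j * rhoSZ P j j - α i * rhoSZ P j i),
      (1 / lam P α i j) * (α j * rhoSZ P i j - α i * rhoSZ P i i);
     (1 / lam P α i j) * (α j * rhoSZ P j j - α i * rhoSZ P j i), 1, rhoSS P i j;
     (1 / lam P α i j) * (α j * rhoSZ P i j - α i * rhoSZ P i i), rhoSS P i j, 1]

/-- The summand
`x_i {1 - Φ₃((-λ_{ij}/2 - (1/λ_{ij}) ln (x̃_i/x̃_j), α_i ρ_{j^*,i} - c_j, α_i ρ_{i^*,i} - c_i); Σ_{i|j})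
  / Φ(α_i ρ_{i^*,i} - c_i)}`, where `x̃_l = x_l / Φ(α_l ρ_{l^*,l} - c_l)`.
For `x_j = 0` the first argument of `Φ₃` is `-∞`, so that `Φ₃ = 0` and the summand is `x_i`;
for `x_i = 0` the summand is `0`. -/
def skewHuslerReissTerm (xi xj : ℝ) : ℝ :=
  if xj = 0 then xi else
    xi * (1 - normalCDF (sigmaCond P α i j)
        ![-(lam P α i j) / 2
            - (1 / lam P α i j) * Real.log ((xi / zeta P α c i) / (xj / zeta P α c j)),
          α i * rhoSZ P j i - c j,
          α i * rhoSZ P i i - c i]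
      / zeta P α c i)

/-- The bivariate skew-Hüsler–Reiss function of `(x_i, x_j)`. -/
def skewHuslerReiss (xi xj : ℝ) : ℝ :=
  skewHuslerReissTerm P α c i j xi xj + skewHuslerReissTerm P α c j i xj xi

end SkewHuslerReiss

end

/-! Given the normal vector, the only remaining randomness is `V₀`. Put W_k = exp(α_k Z_k) 1(Z_k^* >
c_k). Once s ≥ Z_i and t ≥ Z_j, the conditional probability of {X_i > s or X_j > t} is exactly
max(exp(-α_i s) W_i, exp(-α_j t) W_j) (`expMeasure_real_lt_factorMap_or`). Dominated convergence
turns this into a limit of rescaled exceedance probabilities (`tendsto_integral_exceedance`).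

Taking the same index twice gives the marginal tails κ_k exp(-α_k t), with κ_k = E W_k = exp(α_k²/2)
ζ_k. Hence the quantiles q_n at level 1 - x/n satisfy n exp(-α_k q_n) → x/κ_k
(`exists_quantile_tendsto`), and the tail dependence function is E max(x_i W_i/κ_i, x_j W_j/κ_j).

Writing the maximum as sum minus minimum leaves exponentially weighted Gaussian orthant integrals.
Exponential tilting shifts the mean and keeps the covariance, so these are values of Φ₃
(`setIntegral_exp_dotProduct_orthant`). Characteristic functions replace densities throughout, so
`P` may be singular. -/

/-! ### Gaussian vectors: exponential tilting and weighted orthant probabilities -/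

open Matrix in
/-- One-dimensional projections of a multivariate normal law. -/
lemma map_dotProduct_multivariateGaussian {ι : Type*} [Fintype ι] [DecidableEq ι]
    {P : Matrix ι ι ℝ} (hP : P.PosSemidef) (t : ι → ℝ) :
    (multivariateGaussian 0 P).map (fun x : EuclideanSpace ℝ ι => t ⬝ᵥ x.ofLp) =
      gaussianReal 0 (t ⬝ᵥ P *ᵥ t).toNNReal := by
  have hm : Measurable (fun x : EuclideanSpace ℝ ι => t ⬝ᵥ x.ofLp) := by
    unfold dotProduct; fun_prop
  have h0 : 0 ≤ t ⬝ᵥ P *ᵥ t := by simpa using hP.dotProduct_mulVec_nonneg t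
  have := Measure.isProbabilityMeasure_map (μ := multivariateGaussian 0 P) hm.aemeasurable
  refine Measure.ext_of_charFun (funext fun s => ?_)
  rw [charFun_apply_real, integral_map hm.aemeasurable (by fun_prop), charFun_gaussianReal]
  have h := charFun_multivariateGaussian (μ := 0) hP (WithLp.toLp 2 (s • t))
  rw [charFun_apply] at h
  simp only [EuclideanSpace.inner_eq_star_dotProduct] at h
  rw [Real.coe_toNNReal _ h0]
  convert h using 2
  · ext x
    simp [smul_dotProduct]
  · simp [smul_dotProduct, mulVec_smul]
    ring

open Matrix in
/-- The exponential moments of a centred multivariate normal law. -/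
lemma integrable_exp_dotProduct {ι : Type*} [Fintype ι] [DecidableEq ι]
    {P : Matrix ι ι ℝ} (hP : P.PosSemidef) (t : ι → ℝ) :
    Integrable (fun x : EuclideanSpace ℝ ι => Real.exp (t ⬝ᵥ x.ofLp))
      (multivariateGaussian 0 P) := by
  have hm : Measurable (fun x : EuclideanSpace ℝ ι => t ⬝ᵥ x.ofLp) := by
    unfold dotProduct; fun_prop
  have h := integrable_exp_mul_gaussianReal (μ := 0) (v := (t ⬝ᵥ P *ᵥ t).toNNReal) 1
  rw [← map_dotProduct_multivariateGaussian hP, integrable_map_measure (by fun_prop)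
    hm.aemeasurable] at h
  simpa [Function.comp_def] using h

open Matrix in
lemma integral_exp_dotProduct {ι : Type*} [Fintype ι] [DecidableEq ι]
    {P : Matrix ι ι ℝ} (hP : P.PosSemidef) (t : ι → ℝ) :
    ∫ x : EuclideanSpace ℝ ι, Real.exp (t ⬝ᵥ x.ofLp) ∂(multivariateGaussian 0 P) =
      Real.exp (t ⬝ᵥ P *ᵥ t / 2) := by
  have h0 : 0 ≤ t ⬝ᵥ P *ᵥ t := by simpa using hP.dotProduct_mulVec_nonneg t
  have h := mgf_gaussianReal (map_dotProduct_multivariateGaussian hP t) 1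
  simpa [mgf, Real.coe_toNNReal _ h0] using h

open Matrix in
/-- Under the exponential tilting by a linear form `a`, linear images of a centred normal vector
are normal, with unchanged covariance and shifted mean. -/
lemma map_tilted_multivariateGaussian {ι : Type*} [Fintype ι] [DecidableEq ι]
    {P : Matrix ι ι ℝ} (hP : P.PosSemidef) (a : ι → ℝ) {m : ℕ} (b : Fin m → ι → ℝ) :
    ((multivariateGaussian 0 P).tilted (fun x : EuclideanSpace ℝ ι => a ⬝ᵥ x.ofLp)).map
        (fun x => WithLp.toLp 2 (fun k => b k ⬝ᵥ P *ᵥ a - b k ⬝ᵥ x.ofLp)) =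
      multivariateGaussian 0 (Matrix.of fun k l => b k ⬝ᵥ P *ᵥ b l) := by
  have hsymm : ∀ u v : ι → ℝ, u ⬝ᵥ P *ᵥ v = v ⬝ᵥ P *ᵥ u := by
    intro u v
    have hT : Pᵀ = P := by simpa [conjTranspose_eq_transpose_of_trivial] using hP.isHermitian.eq
    rw [dotProduct_mulVec, ← mulVec_transpose, hT, dotProduct_comm]
  have hS : (Matrix.of fun k l => b k ⬝ᵥ P *ᵥ b l).PosSemidef := by
    have h := hP.mul_mul_conjTranspose_same (Matrix.of b)
    convert h using 1
    ext k l
    simp [Matrix.mul_apply, dotProduct, mulVec, Finset.sum_mul, Finset.mul_sum]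
    rw [Finset.sum_comm]
    simp [mul_assoc]
  have hI := integrable_exp_dotProduct hP a
  have hprob := isProbabilityMeasure_tilted hI
  set Q := (multivariateGaussian 0 P).tilted (fun x : EuclideanSpace ℝ ι => a ⬝ᵥ x.ofLp) with hQ
  have hm : Measurable (fun x : EuclideanSpace ℝ ι =>
      WithLp.toLp 2 (fun k => b k ⬝ᵥ P *ᵥ a - b k ⬝ᵥ x.ofLp)) := by
    unfold dotProduct; fun_prop
  have := Measure.isProbabilityMeasure_map (μ := Q) hm.aemeasurable
  refine Measure.ext_of_charFun (funext fun t => ?_)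
  rw [charFun_apply, integral_map hm.aemeasurable (by fun_prop), charFun_multivariateGaussian hS]
  -- Pairing the image vector with `t` gives the scalar `Y` built from `u`, so a one-dimensional
  -- computation suffices.
  set u : ι → ℝ := ∑ k, t k • b k with hu
  have hu1 : ∀ v : ι → ℝ, u ⬝ᵥ v = ∑ k, t k * (b k ⬝ᵥ v) := by
    intro v; simp [hu, sum_dotProduct, smul_dotProduct]
  have hu0 : 0 ≤ u ⬝ᵥ P *ᵥ u := by simpa using hP.dotProduct_mulVec_nonneg u
  set Y : EuclideanSpace ℝ ι → ℝ := fun x => u ⬝ᵥ P *ᵥ a - u ⬝ᵥ x.ofLp with hY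
  have hquad : t.ofLp ⬝ᵥ (Matrix.of fun k l => b k ⬝ᵥ P *ᵥ b l) *ᵥ t.ofLp = u ⬝ᵥ P *ᵥ u := by
    rw [hu1]
    simp only [dotProduct, mulVec, Matrix.of_apply]
    refine Finset.sum_congr rfl fun k _ => ?_
    congr 1
    have := hsymm (b k) u
    rw [hu1] at this
    simp only [hsymm _ (b k)] at this
    simp only [dotProduct, mulVec] at this
    rw [this]
    exact Finset.sum_congr rfl fun l _ => mul_comm _ _
  -- Expanding the quadratic form at `a - s • u`, the term linear in `s` cancels against the shift
  -- `u ⬝ᵥ P *ᵥ a`, and only s² u·Pu/2 remains.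
  have hmgf : mgf Y Q = mgf id (gaussianReal 0 (u ⬝ᵥ P *ᵥ u).toNNReal) := by
    funext s
    rw [mgf_id_gaussianReal, mgf, integral_exp_tilted, integral_exp_dotProduct hP,
      Real.coe_toNNReal _ hu0]
    have e1 : ∀ x : EuclideanSpace ℝ ι, Real.exp (((fun x : EuclideanSpace ℝ ι => a ⬝ᵥ x.ofLp) +
        fun x => s * Y x) x) = Real.exp (s * (u ⬝ᵥ P *ᵥ a)) *
          Real.exp ((a - s • u) ⬝ᵥ x.ofLp) := by
      intro x
      rw [← Real.exp_add]
      congr 1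
      simp only [hY, Pi.add_apply, sub_dotProduct, smul_dotProduct, smul_eq_mul]
      ring
    simp_rw [e1]
    rw [integral_const_mul, integral_exp_dotProduct hP, ← Real.exp_add, ← Real.exp_sub]
    congr 1
    simp only [sub_dotProduct, smul_dotProduct, smul_eq_mul, mulVec_sub, mulVec_smul,
      dotProduct_sub, dotProduct_smul]
    rw [hsymm a u]
    ring
  have hset : integrableExpSet Y Q = Set.univ := by
    rw [integrableExpSet_eq_of_mgf hmgf, integrableExpSet_id_gaussianReal]
  -- Analytic continuation: real moment generating functions that agree and are finite everywhere
  -- have the same complex extension, whose value at `I` gives the characteristic function.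
  have hc := eqOn_complexMGF_of_mgf hmgf (x := Complex.I) (by simp [hset])
  rw [complexMGF_id_gaussianReal, complexMGF] at hc
  rw [hquad]
  convert hc using 2
  · ext x
    congr 1
    rw [mul_comm]
    congr 2
    simp only [hY, hu1, EuclideanSpace.inner_eq_star_dotProduct]
    rw [← Finset.sum_sub_distrib]
    simp [dotProduct, mul_sub]
  · simp [Real.coe_toNNReal _ hu0]
    ring

open Matrix in
/-- Exponentially weighted orthant probabilities of a centred normal vector; the boundary of the
orthant does not matter. -/
lemma setIntegral_exp_dotProduct_orthant {ι : Type*} [Fintype ι] [DecidableEq ι]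
    {P : Matrix ι ι ℝ} (hP : P.PosSemidef) (a : ι → ℝ) {m : ℕ} (b : Fin m → ι → ℝ)
    (hb : ∀ k, b k ⬝ᵥ P *ᵥ b k ≠ 0) (r : Fin m → ℝ) {D : Set (EuclideanSpace ℝ ι)}
    (hD1 : ∀ x, (∀ k, r k < b k ⬝ᵥ x.ofLp) → x ∈ D)
    (hD2 : ∀ x ∈ D, ∀ k, r k ≤ b k ⬝ᵥ x.ofLp) :
    ∫ x in D, Real.exp (a ⬝ᵥ x.ofLp) ∂(multivariateGaussian 0 P) =
      Real.exp (a ⬝ᵥ P *ᵥ a / 2) * normalCDF (Matrix.of fun k l => b k ⬝ᵥ P *ᵥ b l)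
        (fun k => b k ⬝ᵥ P *ᵥ a - r k) := by
  have hI := integrable_exp_dotProduct hP a
  have hprob := isProbabilityMeasure_tilted hI
  have hmeas : ∀ k, Measurable (fun x : EuclideanSpace ℝ ι => b k ⬝ᵥ x.ofLp) := by
    intro k; unfold dotProduct; fun_prop
  have hm : Measurable (fun x : EuclideanSpace ℝ ι =>
      WithLp.toLp 2 (fun k => b k ⬝ᵥ P *ᵥ a - b k ⬝ᵥ x.ofLp)) := by
    unfold dotProduct; fun_prop
  have hms : MeasurableSet {y : EuclideanSpace ℝ (Fin m) | ∀ k, y k ≤ b k ⬝ᵥ P *ᵥ a - r k} := by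
    rw [Set.ofPred_forall]
    exact MeasurableSet.iInter fun k => measurableSet_le (by fun_prop) (by fun_prop)
  -- Each form has nonzero variance, hence an atomless law, even when `P` is singular.
  have hnull : ∀ᵐ x ∂(multivariateGaussian 0 P), ∀ k, b k ⬝ᵥ x.ofLp ≠ r k := by
    rw [ae_all_iff]
    intro k
    have h0 : 0 ≤ b k ⬝ᵥ P *ᵥ b k := by simpa using hP.dotProduct_mulVec_nonneg (b k)
    have hv : (b k ⬝ᵥ P *ᵥ b k).toNNReal ≠ 0 := by
      simpa [Real.toNNReal_eq_zero] using lt_of_le_of_ne h0 (hb k).symm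
    have := nullSingletonClass_gaussianReal (μ := 0) hv
    have h : ∀ᵐ y ∂(gaussianReal 0 (b k ⬝ᵥ P *ᵥ b k).toNNReal), y ≠ r k := by
      rw [ae_iff]; simp
    rw [← map_dotProduct_multivariateGaussian hP] at h
    exact ae_of_ae_map (hmeas k).aemeasurable h
  rw [normalCDF, ← map_tilted_multivariateGaussian hP a b, map_measureReal_apply hm hms,
    measureReal_def, tilted_apply_eq_ofReal_integral, ENNReal.toReal_ofReal (by positivity),
    integral_div, integral_exp_dotProduct hP, mul_div_cancel₀ _ (Real.exp_pos _).ne']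
  refine setIntegral_congr_set ?_
  filter_upwards [hnull] with x hx
  refine propext ⟨fun h => ?_, fun h => ?_⟩
  · intro k
    exact sub_le_sub_left (hD2 x h k) _
  · refine hD1 x fun k => lt_of_le_of_ne ?_ (hx k).symm
    exact (sub_le_sub_iff_left _).1 (h k)

lemma normalCDF_one {S : Matrix (Fin 1) (Fin 1) ℝ} (hS : S.PosSemidef) (h1 : S 0 0 = 1)
    (x : Fin 1 → ℝ) : normalCDF S x = stdNormalCDF (x 0) := by
  have h := measurePreserving_eval_multivariateGaussian (μ := 0) hS (i := 0)
  rw [normalCDF, stdNormalCDF, cdf_eq_real]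
  rw [h1] at h
  simp only [PiLp.zero_apply, Real.toNNReal_one] at h
  rw [← h.map_eq, map_measureReal_apply h.measurable measurableSet_Iic]
  congr 1
  ext y
  simp [Fin.forall_fin_one]

lemma stdNormalCDF_pos (x : ℝ) : 0 < stdNormalCDF x := by
  rw [stdNormalCDF, cdf_eq_real, measureReal_def]
  refine ENNReal.toReal_pos (fun h => ?_) (measure_ne_top _ _)
  have := gaussianReal_absolutelyContinuous' 0 one_ne_zero h
  simp at this

/-! ### The unit exponential tail -/

lemma expMeasure_one_real_Ioi {p : ℝ} (hp : 0 ≤ p) :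
    (expMeasure 1).real (Set.Ioi p) = Real.exp (-p) := by
  have := isProbabilityMeasure_expMeasure one_pos
  rw [← Set.compl_Iic, probReal_compl_eq_one_sub measurableSet_Iic, ← cdf_eq_real,
    cdf_expMeasure_eq one_pos, if_pos hp]
  simp

/-- For negative `p` the right side exceeds 1. Having no sign condition is what permits domination
uniformly in the normal vector. -/
lemma expMeasure_one_real_Ioi_le (p : ℝ) :
    (expMeasure 1).real (Set.Ioi p) ≤ Real.exp (-p) := by
  have := isProbabilityMeasure_expMeasure one_pos
  rcases le_total 0 p with hp | hp
  · exact (expMeasure_one_real_Ioi hp).le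
  · exact measureReal_le_one.trans (Real.one_le_exp (by linarith))

/-! ### Extreme quantiles under an exponential tail -/

lemma cdf_eq_one_sub_real_Ioi (ν : Measure ℝ) [IsProbabilityMeasure ν] (t : ℝ) :
    cdf ν t = 1 - ν.real (Set.Ioi t) := by
  rw [cdf_eq_real, ← Set.compl_Iic, probReal_compl_eq_one_sub measurableSet_Iic]
  ring

/-- For levels strictly between `0` and `1` the generalized inverse is a minimum. -/
lemma exists_quantile_eq (ν : Measure ℝ) [IsProbabilityMeasure ν] {u : ℝ} (h0 : 0 < u)
    (h1 : u < 1) : ∃ q : ℝ, quantile ν u = q ∧ ∀ y, u ≤ cdf ν y ↔ q ≤ y := by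
  set S : Set ℝ := {x : ℝ | u ≤ cdf ν x} with hS
  have hne : S.Nonempty :=
    ((tendsto_cdf_atTop ν).eventually (eventually_ge_nhds h1)).exists
  obtain ⟨L, hL⟩ := ((tendsto_cdf_atBot ν).eventually (eventually_lt_nhds h0)).exists
  have hbdd : BddBelow S := by
    refine ⟨L, fun x hx => ?_⟩
    by_contra hlt
    exact absurd (hx.trans (monotone_cdf ν (not_le.1 hlt).le)) (not_le.2 hL)
  have hgt : ∀ y, sInf S < y → u ≤ cdf ν y := by
    intro y hy
    obtain ⟨x, hx, hxy⟩ := exists_lt_of_csInf_lt hne hy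
    exact le_trans hx (monotone_cdf ν hxy.le)
  -- Right continuity of the distribution function makes the infimum attained.
  have hmem : u ≤ cdf ν (sInf S) := by
    have hc : Tendsto (cdf ν) (𝓝[>] (sInf S)) (𝓝 (cdf ν (sInf S))) :=
      ((cdf ν).right_continuous (sInf S)).mono_left (nhdsWithin_mono _ Set.Ioi_subset_Ici_self)
    refine ge_of_tendsto hc ?_
    filter_upwards [self_mem_nhdsWithin] with y hy using hgt y hy
  refine ⟨sInf S, ?_, fun y => ⟨fun hy => csInf_le hbdd hy,
    fun hy => hmem.trans (monotone_cdf ν hy)⟩⟩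
  refine IsLeast.csInf_eq ⟨⟨_, hmem, rfl⟩, ?_⟩
  rintro _ ⟨x, hx, rfl⟩
  exact EReal.coe_le_coe_iff.2 (csInf_le hbdd hx)

/-- A measure with tail asymptotically `κ exp (-a t)`, `κ > 0`, charges every half-line. -/
lemma real_Ioi_pos_of_tendsto {ν : Measure ℝ} [IsProbabilityMeasure ν] {a κ : ℝ} (hκ : 0 < κ)
    (hν : Tendsto (fun t => Real.exp (a * t) * ν.real (Set.Ioi t)) atTop (𝓝 κ)) (M : ℝ) :
    0 < ν.real (Set.Ioi M) := by
  obtain ⟨t, ht, hMt⟩ := ((hν.eventually (eventually_gt_nhds hκ)).and (eventually_ge_atTop M)).exists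
  exact (pos_of_mul_pos_right ht (Real.exp_pos _).le).trans_le
    (measureReal_mono (Set.Ioi_subset_Ioi hMt))

/-- Serves the boundary of the quadrant: a zero coordinate gives level 1 for every `n`, and an
infinite threshold is never exceeded. -/
lemma quantile_one_eq_top {ν : Measure ℝ} [IsProbabilityMeasure ν]
    (hν : ∀ M, 0 < ν.real (Set.Ioi M)) : quantile ν 1 = ⊤ := by
  have : {x : ℝ | 1 ≤ cdf ν x} = ∅ := by
    ext x
    have := hν x
    simp [cdf_eq_one_sub_real_Ioi, this]
  rw [quantile, this]
  simp

/-- Asymptotics of the extreme quantiles of a law with exponential tail. -/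
lemma exists_quantile_tendsto {ν : Measure ℝ} [IsProbabilityMeasure ν] {a κ : ℝ}
    (hκ : 0 < κ)
    (hν : Tendsto (fun t => Real.exp (a * t) * ν.real (Set.Ioi t)) atTop (𝓝 κ))
    {x : ℝ} (hx : 0 < x) :
    ∃ q : ℕ → ℝ, (∀ᶠ n : ℕ in atTop, quantile ν (1 - x / n) = q n) ∧ Tendsto q atTop atTop ∧
      Tendsto (fun n : ℕ => (n : ℝ) * Real.exp (-(a * q n))) atTop (𝓝 (x / κ)) := by
  have hxn : Tendsto (fun n : ℕ => x / (n : ℝ)) atTop (𝓝 0) :=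
    tendsto_const_div_atTop_nhds_zero_nat x
  -- The implication lets `choose` return a total sequence; its values at the finitely many excluded
  -- `n` are irrelevant.
  have hex : ∀ n : ℕ, ∃ q : ℝ, (0 < n ∧ x / (n : ℝ) < 1) →
      (quantile ν (1 - x / n) = q ∧ ∀ y, 1 - x / n ≤ cdf ν y ↔ q ≤ y) := by
    intro n
    by_cases h : 0 < n ∧ x / (n : ℝ) < 1
    · have hn : 0 < x / (n : ℝ) := div_pos hx (by exact_mod_cast h.1)
      obtain ⟨q, hq⟩ := exists_quantile_eq ν (u := 1 - x / n) (by linarith) (by linarith)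
      exact ⟨q, fun _ => hq⟩
    · exact ⟨0, fun h' => absurd h' h⟩
  choose q hq using hex
  have hev : ∀ᶠ n : ℕ in atTop, 0 < n ∧ x / (n : ℝ) < 1 :=
    (eventually_gt_atTop 0).and (hxn.eventually (eventually_lt_nhds one_pos))
  have hqtop : Tendsto q atTop atTop := by
    refine tendsto_atTop.2 fun M => ?_
    filter_upwards [hev, hxn.eventually (eventually_lt_nhds (real_Ioi_pos_of_tendsto hκ hν M))]
      with n hn hM
    by_contra hlt
    have := ((hq n hn).2 M).2 (not_le.1 hlt).le
    rw [cdf_eq_one_sub_real_Ioi] at this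
    linarith
  refine ⟨q, hev.mono fun n hn => (hq n hn).1, hqtop, ?_⟩
  -- At `q n` the tail is at most x/n, and at any smaller point it exceeds x/n. Comparing `q n` with
  -- `q n - δ n` sandwiches the limit without using continuity of the margin; `δ` vanishes so that
  -- its exponential factor tends to 1.
  set δ : ℕ → ℝ := fun n => 1 / ((n : ℝ) + 1) with hδ
  have hδ0 : Tendsto δ atTop (𝓝 0) := tendsto_one_div_add_atTop_nhds_zero_nat
  have hδpos : ∀ n, 0 < δ n := fun n => by positivity
  have hqδ : Tendsto (fun n => q n - δ n) atTop atTop := by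
    simpa [sub_eq_add_neg] using hqtop.atTop_add hδ0.neg
  have hU : Tendsto (fun n => x / (Real.exp (a * q n) * ν.real (Set.Ioi (q n)))) atTop
      (𝓝 (x / κ)) := tendsto_const_nhds.div (hν.comp hqtop) hκ.ne'
  have hL : Tendsto (fun n => x / (Real.exp (a * (q n - δ n)) * ν.real (Set.Ioi (q n - δ n)))
      * Real.exp (-(a * δ n))) atTop (𝓝 (x / κ)) := by
    have h1 : Tendsto (fun n => Real.exp (-(a * δ n))) atTop (𝓝 1) := by
      have := (Real.continuous_exp.tendsto _).comp ((hδ0.const_mul a).neg)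
      simpa [Function.comp_def] using this
    simpa using (tendsto_const_nhds (x := x).div (hν.comp hqδ) hκ.ne').mul h1
  refine tendsto_of_tendsto_of_tendsto_of_le_of_le' hL hU ?_ ?_
  · filter_upwards [hev] with n hn
    have hn0 : (0 : ℝ) < n := by exact_mod_cast hn.1
    have hpos := real_Ioi_pos_of_tendsto hκ hν (q n - δ n)
    have h : ¬ (1 - x / n ≤ cdf ν (q n - δ n)) := by
      rw [(hq n hn).2]; linarith [hδpos n]
    rw [cdf_eq_one_sub_real_Ioi] at h
    have h' : x ≤ n * ν.real (Set.Ioi (q n - δ n)) := by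
      rw [← div_le_iff₀' hn0]; linarith
    have e : Real.exp (-(a * q n)) = Real.exp (-(a * (q n - δ n))) * Real.exp (-(a * δ n)) := by
      rw [← Real.exp_add]; congr 1; ring
    rw [e, ← mul_assoc]
    refine mul_le_mul_of_nonneg_right ?_ (Real.exp_pos _).le
    rw [div_le_iff₀ (by positivity), Real.exp_neg]
    field_simp
    exact h'
  · filter_upwards [hev] with n hn
    have hn0 : (0 : ℝ) < n := by exact_mod_cast hn.1
    have hpos := real_Ioi_pos_of_tendsto hκ hν (q n)
    have h := ((hq n hn).2 (q n)).2 le_rfl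
    rw [cdf_eq_one_sub_real_Ioi] at h
    have h' : n * ν.real (Set.Ioi (q n)) ≤ x := by
      rw [← le_div_iff₀' hn0]; linarith
    rw [le_div_iff₀ (by positivity), Real.exp_neg]
    field_simp
    exact h'

/-! ### Exceedances of the factor model given the normal vector -/

section FactorModel

variable {d : ℕ} (α c : Fin d → ℝ)

/-- The factor model as a function of the normal vector `x` and the exponential factor `v`. -/
noncomputable def factorMap (i : Fin d) (x : EuclideanSpace ℝ (Fin d ⊕ Fin d)) (v : ℝ) : ℝ :=
  x (.inl i) + (1 / α i) * v * (if c i < x (.inr i) then 1 else 0)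

/-- The weight `exp (α_i z_i) 1(z_i^* > c_i)`. -/
noncomputable def activeWeight (i : Fin d) (x : EuclideanSpace ℝ (Fin d ⊕ Fin d)) : ℝ :=
  if c i < x (.inr i) then Real.exp (α i * x (.inl i)) else 0

variable {α}

lemma activeWeight_nonneg (i : Fin d) (x : EuclideanSpace ℝ (Fin d ⊕ Fin d)) :
    0 ≤ activeWeight α c i x := by
  unfold activeWeight; split_ifs <;> positivity

lemma activeWeight_le (i : Fin d) (x : EuclideanSpace ℝ (Fin d ⊕ Fin d)) :
    activeWeight α c i x ≤ Real.exp (α i * x (.inl i)) := by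
  unfold activeWeight; split_ifs
  · exact le_rfl
  · positivity

lemma measurable_activeWeight (i : Fin d) : Measurable (activeWeight α c i) :=
  Measurable.ite (measurableSet_lt (by fun_prop) (by fun_prop)) (by fun_prop) (by fun_prop)

lemma measurable_factorMap (i : Fin d) :
    Measurable (fun p : EuclideanSpace ℝ (Fin d ⊕ Fin d) × ℝ => factorMap α c i p.1 p.2) := by
  unfold factorMap
  refine Measurable.add (by fun_prop) (Measurable.mul (by fun_prop) (Measurable.ite ?_ ?_ ?_))
  · exact measurableSet_lt (by fun_prop) (by fun_prop)
  · fun_prop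
  · fun_prop

lemma lt_factorMap_iff {i : Fin d} (hα : 0 < α i) {x : EuclideanSpace ℝ (Fin d ⊕ Fin d)}
    (hx : c i < x (.inr i)) (s v : ℝ) :
    s < factorMap α c i x v ↔ α i * (s - x (.inl i)) < v := by
  rw [factorMap, if_pos hx, mul_one, ← sub_lt_iff_lt_add', one_div, ← lt_div_iff₀' hα,
    div_eq_inv_mul]

lemma factorMap_of_not_lt {i : Fin d} {x : EuclideanSpace ℝ (Fin d ⊕ Fin d)}
    (hx : ¬ c i < x (.inr i)) (v : ℝ) : factorMap α c i x v = x (.inl i) := by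
  rw [factorMap, if_neg hx]; simp

/-- Supplies the dominating function. It must also hold when the threshold lies below the normal
part, where the bound is at least 1 if the shock is inactive. -/
lemma expMeasure_real_lt_factorMap_le {i : Fin d} (hα : 0 < α i)
    (x : EuclideanSpace ℝ (Fin d ⊕ Fin d)) (s : ℝ) :
    (expMeasure 1).real {v | s < factorMap α c i x v} ≤
      Real.exp (-(α i * s)) * Real.exp (α i * x (.inl i)) := by
  have := isProbabilityMeasure_expMeasure one_pos
  rw [← Real.exp_add]
  by_cases hx : c i < x (.inr i)
  · simp_rw [lt_factorMap_iff c hα hx]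
    refine (expMeasure_one_real_Ioi_le _).trans_eq ?_
    congr 1; ring
  · simp_rw [factorMap_of_not_lt c hx]
    by_cases hs : s < x (.inl i)
    · refine measureReal_le_one.trans (Real.one_le_exp ?_)
      nlinarith
    · simp [hs]
      positivity

/-- Exceedance probability of a pair given the normal vector, once both thresholds exceed the
normal parts. -/
lemma expMeasure_real_lt_factorMap_or {i j : Fin d} (hi : 0 < α i) (hj : 0 < α j)
    {x : EuclideanSpace ℝ (Fin d ⊕ Fin d)} {s t : ℝ} (hs : x (.inl i) ≤ s)
    (ht : x (.inl j) ≤ t) :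
    (expMeasure 1).real {v | s < factorMap α c i x v ∨ t < factorMap α c j x v} =
      max (Real.exp (-(α i * s)) * activeWeight α c i x)
        (Real.exp (-(α j * t)) * activeWeight α c j x) := by
  have hps : 0 ≤ α i * (s - x (.inl i)) := mul_nonneg hi.le (by linarith)
  have hpt : 0 ≤ α j * (t - x (.inl j)) := mul_nonneg hj.le (by linarith)
  have es : Real.exp (-(α i * (s - x (.inl i)))) =
      Real.exp (-(α i * s)) * Real.exp (α i * x (.inl i)) := by
    rw [← Real.exp_add]; congr 1; ring
  have et : Real.exp (-(α j * (t - x (.inl j)))) =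
      Real.exp (-(α j * t)) * Real.exp (α j * x (.inl j)) := by
    rw [← Real.exp_add]; congr 1; ring
  unfold activeWeight
  by_cases hA : c i < x (.inr i) <;> by_cases hB : c j < x (.inr j)
  -- With both shocks active, the same `v` drives both coordinates: the union is a half-line
  -- starting at the minimum of two levels, and exp(-min) is the maximum of the exponentials.
  · simp_rw [lt_factorMap_iff c hi hA, lt_factorMap_iff c hj hB, if_pos hA, if_pos hB, ← es, ← et,
      ← min_lt_iff]
    refine (expMeasure_one_real_Ioi (le_min hps hpt)).trans ?_
    rw [← Real.exp_monotone.map_max, max_neg_neg]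
  · simp_rw [lt_factorMap_iff c hi hA, factorMap_of_not_lt c hB, if_pos hA, if_neg hB,
      not_lt.2 ht, or_false, ← es, mul_zero, max_eq_left (Real.exp_pos _).le]
    exact expMeasure_one_real_Ioi hps
  · simp_rw [lt_factorMap_iff c hj hB, factorMap_of_not_lt c hA, if_pos hB, if_neg hA,
      not_lt.2 hs, false_or, ← et, mul_zero, max_eq_right (Real.exp_pos _).le]
    exact expMeasure_one_real_Ioi hpt
  · simp_rw [factorMap_of_not_lt c hA, factorMap_of_not_lt c hB, if_neg hA, if_neg hB,
      not_lt.2 hs, not_lt.2 ht]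
    simp

variable {P : Matrix (Fin d ⊕ Fin d) (Fin d ⊕ Fin d) ℝ}

lemma integrable_exp_mul_eval (hP : P.PosSemidef) (i : Fin d) :
    Integrable (fun x : EuclideanSpace ℝ (Fin d ⊕ Fin d) => Real.exp (α i * x (.inl i)))
      (multivariateGaussian 0 P) := by
  simpa using integrable_exp_dotProduct hP (Pi.single (Sum.inl i) (α i))

lemma integrable_activeWeight (hP : P.PosSemidef) (i : Fin d) :
    Integrable (activeWeight α c i) (multivariateGaussian 0 P) := by
  refine (integrable_exp_mul_eval (α := α) hP i).mono'
    (measurable_activeWeight c i).aestronglyMeasurable (ae_of_all _ fun x => ?_)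
  rw [Real.norm_of_nonneg (activeWeight_nonneg c i x)]
  exact activeWeight_le c i x

/-- Dominated convergence: for each fixed normal vector both thresholds eventually exceed the normal
parts, and the exact maximum formula applies. The filter is general so as to cover both real
thresholds (marginal tails) and quantile sequences; `i = j` is allowed and yields the margins. -/
lemma tendsto_integral_exceedance (hP : P.PosSemidef) (hα : ∀ k, 0 < α k) (i j : Fin d)
    {κ : Type*} {l : Filter κ} [l.IsCountablyGenerated] {r s t : κ → ℝ} {a b : ℝ}
    (hr : ∀ n, 0 ≤ r n) (hs : Tendsto s l atTop) (ht : Tendsto t l atTop)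
    (ha : Tendsto (fun n => r n * Real.exp (-(α i * s n))) l (𝓝 a))
    (hb : Tendsto (fun n => r n * Real.exp (-(α j * t n))) l (𝓝 b)) :
    Tendsto (fun n => r n * ∫ x, (expMeasure 1).real
        {v | s n < factorMap α c i x v ∨ t n < factorMap α c j x v} ∂(multivariateGaussian 0 P)) l
      (𝓝 (∫ x, max (a * activeWeight α c i x) (b * activeWeight α c j x)
        ∂(multivariateGaussian 0 P))) := by
  have := isProbabilityMeasure_expMeasure one_pos
  simp_rw [← integral_const_mul]
  refine tendsto_integral_filter_of_dominated_convergence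
    (fun x => (a + 1) * Real.exp (α i * x (.inl i)) + (b + 1) * Real.exp (α j * x (.inl j)))
    ?_ ?_ ?_ ?_
  · refine .of_forall fun n => ?_
    have hms : MeasurableSet {p : EuclideanSpace ℝ (Fin d ⊕ Fin d) × ℝ |
        s n < factorMap α c i p.1 p.2 ∨ t n < factorMap α c j p.1 p.2} :=
      (measurableSet_lt measurable_const (measurable_factorMap c i)).union
        (measurableSet_lt measurable_const (measurable_factorMap c j))
    exact ((measurable_measure_prodMk_left (ν := expMeasure 1) hms).ennreal_toReal.const_mul
      (r n)).aestronglyMeasurable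
  · filter_upwards [ha.eventually (eventually_le_nhds (lt_add_one a)),
      hb.eventually (eventually_le_nhds (lt_add_one b))] with n h1 h2
    refine ae_of_all _ fun x => ?_
    rw [Real.norm_of_nonneg (mul_nonneg (hr n) measureReal_nonneg)]
    calc r n * (expMeasure 1).real
          {v | s n < factorMap α c i x v ∨ t n < factorMap α c j x v}
        ≤ r n * (Real.exp (-(α i * s n)) * Real.exp (α i * x (.inl i)) +
            Real.exp (-(α j * t n)) * Real.exp (α j * x (.inl j))) := by
          refine mul_le_mul_of_nonneg_left ((measureReal_union_le _ _).trans ?_) (hr n)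
          exact add_le_add (expMeasure_real_lt_factorMap_le c (hα i) x _)
            (expMeasure_real_lt_factorMap_le c (hα j) x _)
      _ = r n * Real.exp (-(α i * s n)) * Real.exp (α i * x (.inl i)) +
            r n * Real.exp (-(α j * t n)) * Real.exp (α j * x (.inl j)) := by ring
      _ ≤ _ := by gcongr
  · exact ((integrable_exp_mul_eval hP i).const_mul _).add
      ((integrable_exp_mul_eval hP j).const_mul _)
  · refine ae_of_all _ fun x => ?_
    refine ((ha.mul_const (activeWeight α c i x)).max
      (hb.mul_const (activeWeight α c j x))).congr' ?_
    filter_upwards [hs.eventually (eventually_ge_atTop (x (.inl i))),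
      ht.eventually (eventually_ge_atTop (x (.inl j)))] with n h1 h2
    rw [expMeasure_real_lt_factorMap_or c (hα i) (hα j) h1 h2, mul_max_of_nonneg _ _ (hr n),
      mul_assoc, mul_assoc]

variable {Ω : Type*} {Z Zs : Fin d → Ω → ℝ} {V₀ : Ω → ℝ}

lemma factorModel_eq_factorMap (i : Fin d) (ω : Ω) :
    factorModel α c Z Zs V₀ i ω = factorMap α c i
      (WithLp.toLp 2 (Sum.elim (fun k => Z k ω) (fun k => Zs k ω))) (V₀ ω) := by
  by_cases h : c i < Zs i ω <;> simp [factorModel, factorMap, h]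

variable [MeasurableSpace Ω] {μ : Measure Ω}

lemma aemeasurable_factorModel
    (hZ : AEMeasurable (fun ω => WithLp.toLp 2 (Sum.elim (fun k => Z k ω) (fun k => Zs k ω)) :
      Ω → EuclideanSpace ℝ (Fin d ⊕ Fin d)) μ)
    (hV : AEMeasurable V₀ μ) (i : Fin d) : AEMeasurable (factorModel α c Z Zs V₀ i) μ := by
  rw [funext (factorModel_eq_factorMap c i)]
  exact (measurable_factorMap c i).comp_aemeasurable (hZ.prodMk hV)

/-- Exceedance probabilities of the factor model by conditioning on the normal vector. -/
lemma real_lt_factorModel_or [IsProbabilityMeasure μ]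
    (hZ : HasLaw (fun ω => WithLp.toLp 2 (Sum.elim (fun k => Z k ω) (fun k => Zs k ω)))
      (multivariateGaussian (0 : EuclideanSpace ℝ (Fin d ⊕ Fin d)) P) μ)
    (hV : HasLaw V₀ (expMeasure 1) μ)
    (hindep : IndepFun
      (fun ω => WithLp.toLp 2 (Sum.elim (fun k => Z k ω) (fun k => Zs k ω)) :
        Ω → EuclideanSpace ℝ (Fin d ⊕ Fin d)) V₀ μ) (i j : Fin d) (s t : ℝ) :
    μ.real {ω | s < factorModel α c Z Zs V₀ i ω ∨ t < factorModel α c Z Zs V₀ j ω} =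
      ∫ x, (expMeasure 1).real {v | s < factorMap α c i x v ∨ t < factorMap α c j x v}
        ∂(multivariateGaussian 0 P) := by
  have := isProbabilityMeasure_expMeasure one_pos
  have hms : MeasurableSet {p : EuclideanSpace ℝ (Fin d ⊕ Fin d) × ℝ |
      s < factorMap α c i p.1 p.2 ∨ t < factorMap α c j p.1 p.2} :=
    (measurableSet_lt measurable_const (measurable_factorMap c i)).union
      (measurableSet_lt measurable_const (measurable_factorMap c j))
  simp_rw [factorModel_eq_factorMap]
  have hlaw := IndepFun.hasLaw_prod hZ hV hindep
  have h := hlaw.measureReal_eq hms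
  simp only at h
  rw [h, measureReal_def, Measure.prod_apply hms, ← integral_toReal]
  · rfl
  · exact (measurable_measure_prodMk_left hms).aemeasurable
  · exact ae_of_all _ fun x => measure_lt_top _ _

end FactorModel

/-! ### Evaluating the limit as the skew-Hüsler–Reiss function -/

section Limit

variable {d : ℕ} {P : Matrix (Fin d ⊕ Fin d) (Fin d ⊕ Fin d) ℝ} {α : Fin d → ℝ}
  (c : Fin d → ℝ)

lemma IsCorrelationMatrix.symm {ι : Type*} [Fintype ι] {Q : Matrix ι ι ℝ}
    (hQ : IsCorrelationMatrix Q) (k l : ι) : Q k l = Q l k := by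
  simpa using (hQ.posSemidef.isHermitian.apply k l).symm

lemma lam_comm (hP : IsCorrelationMatrix P) (i j : Fin d) : lam P α i j = lam P α j i := by
  unfold lam rhoZZ
  rw [hP.symm (.inl i) (.inl j)]
  congr 1; ring

lemma zeta_pos (i : Fin d) : 0 < zeta P α c i := stdNormalCDF_pos _

open Matrix in
-- Tilting by α_i Z_i moves the mean of Z_i^* to α_i ρ_{i^*,i}. The value is the constant in the
-- marginal tail.
lemma integral_activeWeight (hP : IsCorrelationMatrix P) (i : Fin d) :
    ∫ x, activeWeight α c i x ∂(multivariateGaussian 0 P) =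
      Real.exp (α i ^ 2 / 2) * zeta P α c i := by
  set b : Fin 1 → (Fin d ⊕ Fin d) → ℝ := fun _ => Pi.single (.inr i) 1 with hb
  set a : (Fin d ⊕ Fin d) → ℝ := Pi.single (.inl i) (α i) with ha
  have hS : (Matrix.of fun k l => b k ⬝ᵥ P *ᵥ b l).PosSemidef := by
    convert hP.posSemidef.submatrix (fun _ : Fin 1 => (Sum.inr i : Fin d ⊕ Fin d)) using 1
    ext k l
    simp [hb]
  have h := setIntegral_exp_dotProduct_orthant hP.posSemidef a b (fun k => by simp [hb, hP.diag])
    (fun _ => c i) (D := {x | c i < x (.inr i)}) (fun x hx => by simpa [hb] using hx 0)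
    (fun x hx k => by simpa [hb] using le_of_lt hx)
  rw [normalCDF_one hS (by simp [hb, hP.diag])] at h
  rw [← integral_indicator (measurableSet_lt (by fun_prop) (by fun_prop))] at h
  rw [zeta, rhoSZ, hP.symm (.inl i)]
  convert h using 2
  · ext x
    simp [activeWeight, Set.indicator, ha]
  · simp [ha, hP.diag, sq]
  · simp [ha, hb]

open Matrix in
lemma setIntegral_exp_eq_normalCDF (hP : IsCorrelationMatrix P) {i j : Fin d}
    (hlam : 0 < lam P α i j) (L : ℝ)
    {D : Set (EuclideanSpace ℝ (Fin d ⊕ Fin d))}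
    (hD1 : ∀ x, c i < x (.inr i) → c j < x (.inr j) →
      L < α j * x (.inl j) - α i * x (.inl i) → x ∈ D)
    (hD2 : ∀ x ∈ D, c i < x (.inr i) ∧ c j < x (.inr j) ∧
      L ≤ α j * x (.inl j) - α i * x (.inl i)) :
    ∫ x in D, Real.exp (α i * x (.inl i)) ∂(multivariateGaussian 0 P) =
      Real.exp (α i ^ 2 / 2) * normalCDF (sigmaCond P α i j)
        ![-(lam P α i j) / 2 - (1 / lam P α i j) * (L + α i ^ 2 / 2 - α j ^ 2 / 2),
          α i * rhoSZ P j i - c j, α i * rhoSZ P i i - c i] := by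
  have hlsq : lam P α i j ^ 2 = α i ^ 2 - 2 * P (.inl i) (.inl j) * α i * α j + α j ^ 2 :=
    Real.sq_sqrt (Real.sqrt_pos.1 hlam).le
  have hl := hlam.ne'
  set l := lam P α i j with hldef
  -- The difference α_j Z_j - α_i Z_i has variance λ_{ij}², so dividing by λ_{ij} normalises it. The
  -- order (difference, Z_j^*, Z_i^*) matches the rows of `sigmaCond`.
  set b : Fin 3 → (Fin d ⊕ Fin d) → ℝ :=
    ![l⁻¹ • (Pi.single (.inl j) (α j) - Pi.single (.inl i) (α i)), Pi.single (.inr j) 1,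
      Pi.single (.inr i) 1] with hb
  set a : (Fin d ⊕ Fin d) → ℝ := Pi.single (.inl i) (α i) with ha
  have hS : (Matrix.of fun k l => b k ⬝ᵥ P *ᵥ b l) = sigmaCond P α i j := by
    ext k m
    fin_cases k <;> fin_cases m <;>
      simp [hb, ha, sigmaCond, rhoSZ, rhoSS, ← hldef, hP.diag, mulVec_sub, mulVec_smul,
        dotProduct_sub, sub_dotProduct, smul_dotProduct, hP.symm (.inr _) (.inl _), hP.symm (.inr j) (.inr i)]
    rw [hP.symm (.inl j) (.inl i)]
    field_simp
    rw [hlsq]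
    ring
  have h := setIntegral_exp_dotProduct_orthant hP.posSemidef a b
    (fun k => by
      have := congrFun (congrFun hS k) k
      rw [Matrix.of_apply] at this
      rw [this]
      fin_cases k <;> simp [sigmaCond])
    ![l⁻¹ * L, c j, c i] (D := D)
    (fun x hx => by
      have h0 := hx 0
      have h1 := hx 1
      have h2 := hx 2
      simp [hb, ha, sub_dotProduct] at h0 h1 h2
      refine hD1 x h2 h1 ?_
      exact (mul_lt_mul_iff_right₀ (inv_pos.2 hlam)).1 h0)
    (fun x hx k => by
      obtain ⟨h2, h1, h0⟩ := hD2 x hx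
      fin_cases k
      · simpa [hb, ha, sub_dotProduct] using mul_le_mul_of_nonneg_left h0 (inv_pos.2 hlam).le
      · simpa [hb] using h1.le
      · simpa [hb] using h2.le)
  rw [hS] at h
  convert h using 2
  · ext x
    simp [ha]
  · simp [ha, hP.diag, sq]
  · congr 1
    ext k
    fin_cases k
    · simp [ha, hb, sub_dotProduct, hP.diag, hP.symm (.inl j) (.inl i)]
      field_simp
      -- Here α_i α_j ρ_{i,j} = (α_i² + α_j² - λ_{ij}²)/2 turns the tilted mean into the -λ_{ij}/2
      -- term and the correction to `L`.
      rw [hlsq]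
      ring
    · simp [ha, hb, rhoSZ, hP.symm (.inr _) (.inl _), mul_comm]
    · simp [ha, hb, rhoSZ, hP.symm (.inr _) (.inl _), mul_comm]

/-- Taking logarithms makes the comparison of weights linear, with threshold log a - log b. The
factors exp(α²/2) inside `a` and `b` absorb the quadratic terms and leave ln(x̃_i/x̃_j). Ties are
left free in `D` so that the strict and the weak comparison are both covered. -/
lemma setIntegral_eq_sub_skewHuslerReissTerm (hP : IsCorrelationMatrix P) {i j : Fin d}
    (hlam : 0 < lam P α i j) {xi xj a b : ℝ} (hxi : 0 < xi) (hxj : 0 < xj)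
    (ha : a = xi / (Real.exp (α i ^ 2 / 2) * zeta P α c i))
    (hb : b = xj / (Real.exp (α j ^ 2 / 2) * zeta P α c j))
    {D : Set (EuclideanSpace ℝ (Fin d ⊕ Fin d))}
    (hD1 : ∀ x, c i < x (.inr i) → c j < x (.inr j) →
      a * Real.exp (α i * x (.inl i)) < b * Real.exp (α j * x (.inl j)) → x ∈ D)
    (hD2 : ∀ x ∈ D, c i < x (.inr i) ∧ c j < x (.inr j) ∧
      a * Real.exp (α i * x (.inl i)) ≤ b * Real.exp (α j * x (.inl j))) :
    ∫ x in D, a * Real.exp (α i * x (.inl i)) ∂(multivariateGaussian 0 P) =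
      xi - skewHuslerReissTerm P α c i j xi xj := by
  have hzi := zeta_pos (P := P) (α := α) c i
  have hzj := zeta_pos (P := P) (α := α) c j
  have ha0 : 0 < a := by rw [ha]; positivity
  have hb0 : 0 < b := by rw [hb]; positivity
  have key : ∀ x : EuclideanSpace ℝ (Fin d ⊕ Fin d),
      a * Real.exp (α i * x (.inl i)) = Real.exp (Real.log a + α i * x (.inl i)) ∧
      b * Real.exp (α j * x (.inl j)) = Real.exp (Real.log b + α j * x (.inl j)) := by
    intro x
    rw [Real.exp_add, Real.exp_add, Real.exp_log ha0, Real.exp_log hb0]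
    exact ⟨rfl, rfl⟩
  have h := setIntegral_exp_eq_normalCDF c hP hlam (Real.log a - Real.log b) (D := D)
    (fun x h1 h2 h3 => hD1 x h1 h2 (by
      rw [(key x).1, (key x).2, Real.exp_lt_exp]; linarith))
    (fun x hx => by
      obtain ⟨h1, h2, h3⟩ := hD2 x hx
      refine ⟨h1, h2, ?_⟩
      rw [(key x).1, (key x).2, Real.exp_le_exp] at h3; linarith)
  have hlog : Real.log a - Real.log b + α i ^ 2 / 2 - α j ^ 2 / 2 =
      Real.log ((xi / zeta P α c i) / (xj / zeta P α c j)) := by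
    have ea : a = (xi / zeta P α c i) / Real.exp (α i ^ 2 / 2) := by
      rw [ha, div_div, mul_comm]
    have eb : b = (xj / zeta P α c j) / Real.exp (α j ^ 2 / 2) := by
      rw [hb, div_div, mul_comm]
    rw [Real.log_div (by positivity) (by positivity), ea, eb,
      Real.log_div (x := xi / zeta P α c i) (by positivity) (by positivity),
      Real.log_div (x := xj / zeta P α c j) (by positivity) (by positivity), Real.log_exp,
      Real.log_exp]
    ring
  rw [integral_const_mul, h, hlog, skewHuslerReissTerm, if_neg hxj.ne', ha]
  field_simp
  ring

/-- The limiting mean of the maximum of the weights is the skew-Hüsler–Reiss function. -/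
lemma integral_max_activeWeight (hP : IsCorrelationMatrix P) {i j : Fin d}
    (hlam : 0 < lam P α i j) {xi xj a b : ℝ} (hxi : 0 < xi) (hxj : 0 < xj)
    (ha : a = xi / (Real.exp (α i ^ 2 / 2) * zeta P α c i))
    (hb : b = xj / (Real.exp (α j ^ 2 / 2) * zeta P α c j)) :
    ∫ x, max (a * activeWeight α c i x) (b * activeWeight α c j x) ∂(multivariateGaussian 0 P) =
      skewHuslerReiss P α c i j xi xj := by
  have hzi := zeta_pos (P := P) (α := α) c i
  have hzj := zeta_pos (P := P) (α := α) c j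
  have ha0 : 0 < a := by rw [ha]; positivity
  have hb0 : 0 < b := by rw [hb]; positivity
  -- `Di` and `Dj` split the event that both shocks are active according to the smaller weight; ties
  -- go to `Di`, so nothing is counted twice.
  set Di : Set (EuclideanSpace ℝ (Fin d ⊕ Fin d)) := {x | (c i < x (.inr i) ∧ c j < x (.inr j)) ∧
    a * Real.exp (α i * x (.inl i)) ≤ b * Real.exp (α j * x (.inl j))} with hDi
  set Dj : Set (EuclideanSpace ℝ (Fin d ⊕ Fin d)) := {x | (c i < x (.inr i) ∧ c j < x (.inr j)) ∧
    b * Real.exp (α j * x (.inl j)) < a * Real.exp (α i * x (.inl i))} with hDj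
  have ml : ∀ k, MeasurableSet {x : EuclideanSpace ℝ (Fin d ⊕ Fin d) | c k < x (.inr k)} :=
    fun k => measurableSet_lt (by fun_prop) (by fun_prop)
  have me : ∀ k (r : ℝ), Measurable fun x : EuclideanSpace ℝ (Fin d ⊕ Fin d) =>
      r * Real.exp (α k * x (.inl k)) := fun k r => by fun_prop
  have mDi : MeasurableSet Di := ((ml i).inter (ml j)).inter (measurableSet_le (me i a) (me j b))
  have mDj : MeasurableSet Dj := ((ml i).inter (ml j)).inter (measurableSet_lt (me j b) (me i a))
  have hIi := setIntegral_eq_sub_skewHuslerReissTerm c hP hlam hxi hxj ha hb (D := Di)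
    (fun x h1 h2 h3 => ⟨⟨h1, h2⟩, h3.le⟩) (fun x hx => ⟨hx.1.1, hx.1.2, hx.2⟩)
  have hIj := setIntegral_eq_sub_skewHuslerReissTerm c hP (lam_comm (α := α) hP i j ▸ hlam)
    hxj hxi hb ha (D := Dj)
    (fun x h1 h2 h3 => ⟨⟨h2, h1⟩, h3⟩) (fun x hx => ⟨hx.1.2, hx.1.1, hx.2.le⟩)
  -- Maximum = sum - minimum; the minimum vanishes unless both shocks are active.
  have hdec : ∀ x, max (a * activeWeight α c i x) (b * activeWeight α c j x) =
      (a * activeWeight α c i x - Di.indicator (fun x => a * Real.exp (α i * x (.inl i))) x) +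
      (b * activeWeight α c j x - Dj.indicator (fun x => b * Real.exp (α j * x (.inl j))) x) := by
    intro x
    by_cases hA : c i < x (.inr i) <;> by_cases hB : c j < x (.inr j)
    · rcases le_or_gt (a * Real.exp (α i * x (.inl i))) (b * Real.exp (α j * x (.inl j))) with h | h
      · simp [activeWeight, hA, hB, hDi, hDj, Set.indicator, h, not_lt.2 h]
      · simp [activeWeight, hA, hB, hDi, hDj, Set.indicator, h, not_le.2 h, h.le]
    · simp [activeWeight, hA, hB, hDi, hDj, Set.indicator]; positivity
    · simp [activeWeight, hA, hB, hDi, hDj, Set.indicator]; positivity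
    · simp [activeWeight, hA, hB, hDi, hDj, Set.indicator]
  have ii := (integrable_activeWeight (α := α) c hP.posSemidef i).const_mul a
  have ij := (integrable_activeWeight (α := α) c hP.posSemidef j).const_mul b
  have ei := ((integrable_exp_mul_eval (α := α) hP.posSemidef i).const_mul a).indicator mDi
  have ej := ((integrable_exp_mul_eval (α := α) hP.posSemidef j).const_mul b).indicator mDj
  simp_rw [hdec]
  rw [integral_add (by exact ii.sub ei) (by exact ij.sub ej), integral_sub ii ei, integral_sub ij ej,
    integral_indicator mDi, integral_indicator mDj, hIi, hIj, integral_const_mul,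
    integral_const_mul, integral_activeWeight c hP, integral_activeWeight c hP, ha, hb,
    div_mul_cancel₀ _ (by positivity), div_mul_cancel₀ _ (by positivity), skewHuslerReiss]
  ring

end Limit

/-! ### From the copula to exceedances, and the theorem -/

lemma one_sub_bivariateCopula {Ω : Type*} [MeasurableSpace Ω] {μ : Measure Ω}
    [IsProbabilityMeasure μ] {X Y : Ω → ℝ} (hX : AEMeasurable X μ) (hY : AEMeasurable Y μ)
    (u v : ℝ) :
    1 - bivariateCopula μ X Y u v =
      μ.real {ω | quantile (μ.map X) u < X ω ∨ quantile (μ.map Y) v < Y ω} := by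
  rw [bivariateCopula, ← probReal_compl_eq_one_sub₀]
  · congr 1
    ext ω
    simp only [Set.mem_compl_iff, Set.mem_ofPred_eq, not_and_or, not_le]
  · exact (nullMeasurableSet_le (measurable_coe_real_ereal.comp_aemeasurable hX)
      aemeasurable_const).inter (nullMeasurableSet_le
        (measurable_coe_real_ereal.comp_aemeasurable hY) aemeasurable_const)

theorem proposition3 {Ω : Type*} [MeasurableSpace Ω] (μ : Measure Ω) [IsProbabilityMeasure μ]
    {d : ℕ} (P : Matrix (Fin d ⊕ Fin d) (Fin d ⊕ Fin d) ℝ) (hP : IsCorrelationMatrix P)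
    (α c : Fin d → ℝ) (hα : ∀ k, 0 < α k)
    (Z Zs : Fin d → Ω → ℝ) (V₀ : Ω → ℝ)
    (hZ : HasLaw (fun ω => WithLp.toLp 2 (Sum.elim (fun k => Z k ω) (fun k => Zs k ω)))
      (multivariateGaussian (0 : EuclideanSpace ℝ (Fin d ⊕ Fin d)) P) μ)
    (hV : HasLaw V₀ (expMeasure 1) μ)
    (hindep : IndepFun
      (fun ω => WithLp.toLp 2 (Sum.elim (fun k => Z k ω) (fun k => Zs k ω)) :
        Ω → EuclideanSpace ℝ (Fin d ⊕ Fin d)) V₀ μ)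
    (i j : Fin d) (hij : i ≠ j) (hlam : 0 < lam P α i j) :
    IsStableTailDependenceFunction
      (bivariateCopula μ (factorModel α c Z Zs V₀ i) (factorModel α c Z Zs V₀ j))
      (skewHuslerReiss P α c i j) := by
  set X : Fin d → Ω → ℝ := factorModel α c Z Zs V₀ with hXdef
  have hX : ∀ k, AEMeasurable (X k) μ := fun k =>
    aemeasurable_factorModel c hZ.aemeasurable hV.aemeasurable k
  have hprob : ∀ k, IsProbabilityMeasure (μ.map (X k)) := fun k =>
    Measure.isProbabilityMeasure_map (hX k)
  set κ : Fin d → ℝ := fun k => Real.exp (α k ^ 2 / 2) * zeta P α c k with hκdef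
  have hκ : ∀ k, 0 < κ k := fun k => mul_pos (Real.exp_pos _) (zeta_pos c k)
  have hexceed : ∀ (k l : Fin d) (s t : ℝ), μ.real {ω | s < X k ω ∨ t < X l ω} = _ :=
    fun k l s t => real_lt_factorModel_or (α := α) c hZ hV hindep k l s t
  have htail : ∀ k, Tendsto (fun t => Real.exp (α k * t) * (μ.map (X k)).real (Set.Ioi t)) atTop
      (𝓝 (κ k)) := by
    intro k
    have h := tendsto_integral_exceedance (α := α) c hP.posSemidef hα k k (l := atTop)
      (r := fun t : ℝ => Real.exp (α k * t)) (s := id) (t := id) (a := 1) (b := 1)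
      (fun t => (Real.exp_pos _).le) tendsto_id tendsto_id
      (by simp [← Real.exp_add]) (by simp [← Real.exp_add])
    simp only [one_mul, max_self, integral_activeWeight c hP, ← hexceed] at h
    refine h.congr fun t => ?_
    rw [map_measureReal_apply_of_aemeasurable (hX k) measurableSet_Ioi]
    simp only [or_self]
    rfl
  have hpos : ∀ k M, 0 < (μ.map (X k)).real (Set.Ioi M) := fun k =>
    real_Ioi_pos_of_tendsto (hκ k) (htail k)
  -- On an axis of the quadrant only one coordinate can exceed its threshold, and this limit is all
  -- that remains.
  have hsingle : ∀ k x, 0 < x → Tendsto (fun n : ℕ => (n : ℝ) *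
      μ.real {ω | quantile (μ.map (X k)) (1 - x / n) < X k ω}) atTop (𝓝 x) := by
    intro k x hx
    obtain ⟨q, hq, hqtop, hqlim⟩ := exists_quantile_tendsto (hκ k) (htail k) hx
    have h := tendsto_integral_exceedance (α := α) c hP.posSemidef hα k k
      (fun n : ℕ => n.cast_nonneg) hqtop hqtop hqlim hqlim
    simp only [max_self, integral_const_mul, integral_activeWeight c hP, ← hexceed] at h
    rw [div_mul_cancel₀ _ (hκ k).ne'] at h
    refine h.congr' ?_
    filter_upwards [hq] with n hn
    simp [hn]
  intro x y hx hy
  simp_rw [one_sub_bivariateCopula (hX i) (hX j)]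
  rcases hx.eq_or_lt with rfl | hx <;> rcases hy.eq_or_lt with rfl | hy
  · simp [quantile_one_eq_top (hpos _), skewHuslerReiss, skewHuslerReissTerm]
  · simpa [quantile_one_eq_top (hpos _), skewHuslerReiss, skewHuslerReissTerm] using hsingle j y hy
  · simpa [quantile_one_eq_top (hpos _), skewHuslerReiss, skewHuslerReissTerm] using hsingle i x hx
  · obtain ⟨q, hq, hqtop, hqlim⟩ := exists_quantile_tendsto (hκ i) (htail i) hx
    obtain ⟨p, hp, hptop, hplim⟩ := exists_quantile_tendsto (hκ j) (htail j) hy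
    have h := tendsto_integral_exceedance (α := α) c hP.posSemidef hα i j
      (fun n : ℕ => n.cast_nonneg) hqtop hptop hqlim hplim
    rw [integral_max_activeWeight c hP hlam hx hy rfl rfl] at h
    refine h.congr' ?_
    filter_upwards [hq, hp] with n hn hn'
    simp [hn, hn', ← hexceed]
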